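/- Let $\mathbb T=\mathbb R\cup\{a^\nu : a\in\mathbb R\}\cup\{-\infty\}$ be the extended tropical semiring, where $\{a^\nu\}$ is a second (ghost) copy of $\mathbb R$. It is totally ordered by: $-\infty$ is the least element; if $a<b$ are real then each of $a,a^\nu$ is smaller than each of $b,b^\nu$; and $a\prec a^\nu$. Addition is $x\oplus y=\max_{\prec}\{x,y\}$ if $x\ne y$, $a\oplus a=a^\nu\oplus a^\nu=a^\nu$, and $-\infty\oplus-\infty=-\infty$. Multiplication is $a\odot b=a+b$, $a^\nu\odot b=a\odot b^\nu=a^\nu\odot b^\nu=(a+b)^\nu$, and $-\infty\odot x=x\odot -\infty=-\infty$. Write $\bar{\mathbb R}=\mathbb R\cup\{-\infty\}$ and $\bar{\mathbb U}=\{a^\nu : a\in\mathbb R\}\cup\{-\infty\}$. Vectors $v_1,\dots,v_k\in\mathbb T^{(n)}$ are tropically dependent if there are $\alpha_1,\dots,\alpha_k\in\bar{\mathbb R}$, not all $-\infty$, with $\alpha_1v_1\oplus\cdots\oplus\alpha_kv_k\in\bar{\mathbb U}^{(n)}$, and tropically independent otherwise. The tropical rank $\operatorname{rk}(A)$ of an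 $m\times n$ matrix $A$ over $\mathbb T$ is the maximal number of tropically independent rows of $A$. A $k\times k$ matrix $B=(b_{i,j})$ over $\mathbb T$ is nonsingular if $|B|=\bigoplus_{\sigma\in S_k}b_{1,\sigma(1)}\odot\cdots\odot b_{k,\sigma(k)}\notin\bar{\mathbb U}$; the empty matrix ($k=0$) counts as nonsingular. Then for every $m\times n$ matrix $A$ over $\mathbb T$, $$\operatorname{rk}(A)=\operatorname{rk}(A^{\mathrm t}),$$ and both numbers are equal to the largest $k$ such that $A$ has a nonsingular $k\times k$ minor (that is, square submatrix). -/

import Mathlib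

/-- The extended tropical semiring: two copies of `ℝ`, the real part and the ghost part,
together with a common bottom element `-∞`. -/
inductive ExtTrop : Type
  | negInf : ExtTrop
  | real : ℝ → ExtTrop
  | ghost : ℝ → ExtTrop

noncomputable section

namespace ExtTrop

open scoped Classical in
instance : DecidableEq ExtTrop := fun _ _ => inferInstance

/-- The strict total order: `-∞` is the least element, elements of different underlying real
value are compared by that value, and `a ≺ a^ν`. -/
def prec : ExtTrop → ExtTrop → Prop
  | _, negInf => False
  | negInf, real _ => True
  | negInf, ghost _ => True
  | real a, real b => a < b
  | real a, ghost b => a ≤ b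
  | ghost a, real b => a < b
  | ghost a, ghost b => a < b

/-- The ghost map `ν`. -/
def nu : ExtTrop → ExtTrop
  | negInf => negInf
  | real a => ghost a
  | ghost a => ghost a

open scoped Classical in
/-- The maximum of two elements for `prec`. -/
def tmax (x y : ExtTrop) : ExtTrop := if prec x y then y else x

/-- Tropical addition: the maximum if the summands differ, and the ghost of the common
value if they agree (where `-∞ ⊕ -∞ = -∞`). -/
def tadd (x y : ExtTrop) : ExtTrop := if x = y then nu x else tmax x y

/-- Tropical multiplication: addition of the underlying reals; a product with a ghost factor
is ghost, and a product with a factor `-∞` is `-∞`. -/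
def tmul : ExtTrop → ExtTrop → ExtTrop
  | negInf, _ => negInf
  | _, negInf => negInf
  | real a, real b => real (a + b)
  | real a, ghost b => ghost (a + b)
  | ghost a, real b => ghost (a + b)
  | ghost a, ghost b => ghost (a + b)

instance : Zero ExtTrop := ⟨negInf⟩
instance : One ExtTrop := ⟨real 0⟩
instance : Add ExtTrop := ⟨tadd⟩
instance : Mul ExtTrop := ⟨tmul⟩

theorem zero_def : (0 : ExtTrop) = negInf := rfl
theorem one_def : (1 : ExtTrop) = real 0 := rfl
theorem add_def (x y : ExtTrop) : x + y = tadd x y := rfl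
theorem mul_def (x y : ExtTrop) : x * y = tmul x y := rfl

theorem prec_trichotomy (x y : ExtTrop) : prec x y ∨ x = y ∨ prec y x := by
  rcases x with _ | a | a <;> rcases y with _ | b | b <;> simp [prec] <;> grind

theorem prec_asymm {x y : ExtTrop} (h : prec x y) : ¬ prec y x := by
  rcases x with _ | a | a <;> rcases y with _ | b | b <;> simp_all [prec] <;> grind

theorem prec_trans {x y z : ExtTrop} (h : prec x y) (h' : prec y z) : prec x z := by
  rcases x with _ | a | a <;> rcases y with _ | b | b <;> rcases z with _ | c | c <;>
    simp_all [prec] <;> grind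

protected theorem add_comm' (x y : ExtTrop) : x + y = y + x := by
  rcases x with _ | a | a <;> rcases y with _ | b | b <;>
    simp [add_def, tadd, tmax, prec, nu] <;> grind

protected theorem add_assoc' (x y z : ExtTrop) : x + y + z = x + (y + z) := by
  rcases x with _ | a | a <;> rcases y with _ | b | b <;> rcases z with _ | c | c <;>
    simp only [add_def, tadd, tmax] <;> grind [prec, nu]

protected theorem mul_add' (x y z : ExtTrop) : x * (y + z) = x * y + x * z := by
  rcases x with _ | a | a <;> rcases y with _ | b | b <;> rcases z with _ | c | c <;>
    simp only [add_def, mul_def, tadd, tmax, tmul] <;> grind [prec, nu, tmul]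

protected theorem mul_comm' (x y : ExtTrop) : x * y = y * x := by
  rcases x with _ | a | a <;> rcases y with _ | b | b <;> simp [mul_def, tmul, add_comm]

protected theorem mul_assoc' (x y z : ExtTrop) : x * y * z = x * (y * z) := by
  rcases x with _ | a | a <;> rcases y with _ | b | b <;> rcases z with _ | c | c <;>
    simp [mul_def, tmul, add_assoc]

protected theorem zero_add' (x : ExtTrop) : 0 + x = x := by
  rcases x with _ | a | a <;> simp [zero_def, add_def, tadd, tmax, prec, nu]

protected theorem one_mul' (x : ExtTrop) : 1 * x = x := by
  rcases x with _ | a | a <;> simp [one_def, mul_def, tmul]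

protected theorem zero_mul' (x : ExtTrop) : 0 * x = 0 := rfl

instance : CommSemiring ExtTrop where
  add_assoc := ExtTrop.add_assoc'
  zero_add := ExtTrop.zero_add'
  add_zero x := by rw [ExtTrop.add_comm', ExtTrop.zero_add']
  add_comm := ExtTrop.add_comm'
  mul_assoc := ExtTrop.mul_assoc'
  one_mul := ExtTrop.one_mul'
  mul_one x := by rw [ExtTrop.mul_comm', ExtTrop.one_mul']
  mul_comm := ExtTrop.mul_comm'
  zero_mul := ExtTrop.zero_mul'
  mul_zero x := by rw [ExtTrop.mul_comm', ExtTrop.zero_mul']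
  left_distrib := ExtTrop.mul_add'
  right_distrib x y z := by
    rw [ExtTrop.mul_comm', ExtTrop.mul_add', ExtTrop.mul_comm' z x, ExtTrop.mul_comm' z y]
  nsmul := nsmulRec

/-- The real part with `-∞` adjoined. -/
def realBar : Set ExtTrop := {x | x = negInf ∨ ∃ a : ℝ, x = real a}

/-- The ghost part with `-∞` adjoined. -/
def ghostBar : Set ExtTrop := {x | x = negInf ∨ ∃ a : ℝ, x = ghost a}

/-- A finite collection of vectors is tropically dependent if some linear combination, with
coefficients in `ℝ ∪ {-∞}` that are not all `-∞`, has only ghost or `-∞` entries. -/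
def TropDependent {ι : Type*} [Fintype ι] {n : ℕ} (v : ι → Fin n → ExtTrop) : Prop :=
  ∃ α : ι → ExtTrop, (∀ i, α i ∈ realBar) ∧ (∃ i, α i ≠ negInf) ∧
    ∀ j, (∑ i, α i • v i) j ∈ ghostBar

/-- Tropical independence of a finite collection of vectors. -/
def TropIndependent {ι : Type*} [Fintype ι] {n : ℕ} (v : ι → Fin n → ExtTrop) : Prop :=
  ¬ TropDependent v

open scoped Classical in
/-- The tropical rank of a matrix: the maximal number of tropically independent rows. -/
def tropRank {m n : ℕ} (A : Matrix (Fin m) (Fin n) ExtTrop) : ℕ :=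
  (Finset.univ.filter fun s : Finset (Fin m) =>
    TropIndependent fun i : s => A.row i).sup Finset.card

/-- The tropical determinant `⨁_σ a_{1,σ(1)} ⋯ a_{n,σ(n)}`. -/
def tropDet {n : ℕ} (A : Matrix (Fin n) (Fin n) ExtTrop) : ExtTrop :=
  ∑ σ : Equiv.Perm (Fin n), ∏ i, A i (σ i)

/-- A square matrix is tropically singular if its determinant is ghost or `-∞`. -/
def TropSingular {n : ℕ} (A : Matrix (Fin n) (Fin n) ExtTrop) : Prop :=
  tropDet A ∈ ghostBar

/-- The sizes `k` of the tropically nonsingular `k × k` minors (square submatrices) of `A`.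
The empty minor, whose determinant is the unit element, is allowed. -/
def nonsingularMinorSizes {m n : ℕ} (A : Matrix (Fin m) (Fin n) ExtTrop) : Set ℕ :=
  {k | ∃ (r : Fin k ↪o Fin m) (c : Fin k ↪o Fin n), ¬ TropSingular (A.submatrix r c)}

end ExtTrop

end

open Finset Filter Topology

/-! Exponentiation turns `⊕` into maximum and `⊙` into multiplication on nonnegative reals; the
marks `t` remember which entries are real rather than ghost or `-∞`. Dependence of rows becomes a
balanced vector: no marked entry strictly dominates its column. A nonsingular maximal minor becomes
a strict transversal. The theorem thus rests on the alternative `not_hasBalancedVector_iff`: exactly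
one of the two exists.

They exclude each other by multiplying the balance inequalities along a cycle of rows. For existence
in the square positive case, tropical cofactors along a suitable column form a balanced vector; zero
entries follow by compactness. For rectangular arrays, raising entries to a high power replaces
maxima by sums, so balance becomes linear up to a factor at most the number of rows. Helly's theorem
in the simplex then reduces to square arrays, and taking roots sends the factor to `1`.

Hence independent sets of `k` rows correspond to nonsingular `k × k` minors, a notion invariant
under transposition. -/

/-- There is a nonzero nonnegative vector `x` such that in each column `j` every marked entry
`(i, j)`, weighted by `u` and `x`, is bounded by another entry of the column, weighted by `v`
and `x`. -/
def HasBalancedVector {ι κ : Type*} (u v : ι → κ → ℝ) (t : ι → κ → Prop) : Prop :=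
  ∃ x : ι → ℝ, 0 ≤ x ∧ x ≠ 0 ∧ ∀ i j, t i j → ∃ i' ≠ i, u i j * x i ≤ v i' j * x i'

/-- There is a choice of one marked entry in each row whose product is strictly greater than the
product of every other transversal of the same columns. -/
def HasStrictTransversal {ι κ : Type*} [Fintype ι] (w : ι → κ → ℝ) (t : ι → κ → Prop) : Prop :=
  ∃ c : ι → κ, (∀ i, t i (c i)) ∧
    ∀ τ : Equiv.Perm ι, τ ≠ 1 → ∏ i, w i (c (τ i)) < ∏ i, w i (c i)

/-! ### Square arrays and limits -/

section

variable {ι κ : Type*} [Fintype ι]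

/-- Balance sends each row to another row dominating it in its transversal column. Following these
rows on the support of `x` ends in a cycle, and the product around it yields a competing transversal
that is at least as large. -/
theorem not_hasBalancedVector_of_hasStrictTransversal {w : ι → κ → ℝ} {t : ι → κ → Prop}
    (hw : ∀ i j, 0 ≤ w i j) (ht : ∀ i j, t i j → 0 < w i j) (h : HasStrictTransversal w t) :
    ¬ HasBalancedVector w w t := by
  classical
  rintro ⟨x, hx0, hxne, hx⟩
  obtain ⟨c, hct, hc⟩ := h
  have hx0 : ∀ i, 0 ≤ x i := hx0
  choose f hfne hf using fun i => hx i (c i) (hct i)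
  set F : ι → ι := fun i => if x i = 0 then i else f i with hF
  have hpos : ∀ i, x i ≠ 0 → x (F i) ≠ 0 := by
    intro i hi h0
    have h1 : 0 < x i := lt_of_le_of_ne (hx0 i) (Ne.symm hi)
    have h2 := hf i
    simp only [hF, if_neg hi] at h0
    rw [h0, mul_zero] at h2
    exact absurd h2 (not_le.2 (mul_pos (ht _ _ (hct i)) h1))
  -- Zeros become `1` so that the product of all weights is positive and cancels below; `F` fixes
  -- those rows.
  set y : ι → ℝ := fun i => if x i = 0 then 1 else x i with hy
  have hypos : ∀ i, 0 < y i := by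
    intro i
    simp only [hy]
    split_ifs with h0
    · exact one_pos
    · exact lt_of_le_of_ne (hx0 i) (Ne.symm h0)
  have hFy : ∀ i, w i (c i) * y i ≤ w (F i) (c i) * y (F i) := by
    intro i
    by_cases h0 : x i = 0
    · simp [hF, h0]
    · have h1 := hpos i h0
      have h2 := hf i
      simp only [hF, if_neg h0] at h1
      simpa [hy, hF, h0, h1] using h2
  set P := Function.periodicPts F with hP
  have hbij := Function.bijOn_periodicPts F
  -- `F` is bijective on its periodic points; extending by the identity gives a permutation.
  set g : ι → ι := fun i => if i ∈ P then F i else i with hg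
  have hginj : Function.Injective g := by
    intro a b hab
    simp only [hg] at hab
    split_ifs at hab with ha hb hb
    · exact hbij.injOn ha hb hab
    · exact absurd (hab ▸ hbij.mapsTo ha) hb
    · exact absurd (hab ▸ hbij.mapsTo hb) ha
    · exact hab
  set ρ : Equiv.Perm ι := Equiv.ofBijective g (Finite.injective_iff_bijective.1 hginj) with hρ
  have hρg : ∀ i, ρ i = g i := fun i => rfl
  have hρne : ρ ≠ 1 := by
    obtain ⟨a, ha⟩ : ∃ a, x a ≠ 0 := by
      by_contra hcon
      push Not at hcon
      exact hxne (funext hcon)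
    have hit : ∀ n, x (F^[n] a) ≠ 0 := by
      intro n
      induction n with
      | zero => exact ha
      | succ n ih => rw [Function.iterate_succ_apply']; exact hpos _ ih
    obtain ⟨m, n, hmn, heq⟩ := Finite.exists_ne_map_eq_of_infinite (fun n : ℕ => F^[n] a)
    wlog hlt : m < n generalizing m n
    · exact this n m hmn.symm heq.symm (lt_of_le_of_ne (not_lt.1 hlt) hmn.symm)
    have hper : F^[m] a ∈ P := by
      refine Function.mk_mem_periodicPts (n := n - m) (by omega) ?_
      change F^[n - m] (F^[m] a) = F^[m] a
      rw [← Function.iterate_add_apply, Nat.sub_add_cancel hlt.le]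
      exact heq.symm
    intro h1
    have h2 : F^[m] a = F (F^[m] a) := by
      simpa only [h1, Equiv.Perm.one_apply, hg, if_pos hper] using hρg (F^[m] a)
    exact hfne _ (h2.trans (if_neg (hit m))).symm
  have hρy : ∀ i, w i (c i) * y i ≤ w (ρ i) (c i) * y (ρ i) := by
    intro i
    rw [hρg]
    by_cases h0 : i ∈ P
    · simpa [hg, h0] using hFy i
    · simp [hg, h0]
  have hprod : ∏ i, w i (c i) * y i ≤ ∏ i, w (ρ i) (c i) * y (ρ i) :=
    Finset.prod_le_prod (fun i _ => mul_nonneg (hw _ _) (hypos i).le) fun i _ => hρy i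
  rw [Finset.prod_mul_distrib, Finset.prod_mul_distrib, Equiv.prod_comp ρ y] at hprod
  have hle := le_of_mul_le_mul_right hprod (Finset.prod_pos fun i _ => hypos i)
  have hlt := hc ρ⁻¹ (inv_ne_one.2 hρne)
  rw [← Equiv.prod_comp ρ (fun i => w i (c (ρ⁻¹ i)))] at hlt
  simp only [Equiv.Perm.inv_def, Equiv.symm_apply_apply] at hlt
  exact absurd hle (not_le.2 hlt)

/-- Tropical Cramer rule for square arrays with positive entries. -/
theorem hasBalancedVector_of_pos {u : ι → ι → ℝ} {t : ι → ι → Prop}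
    (hu : ∀ i j, 0 < u i j) (h : ¬ HasStrictTransversal u t) : HasBalancedVector u u t := by
  classical
  obtain ⟨σ, -, hσ⟩ := Finset.exists_max_image (univ : Finset (Equiv.Perm ι))
    (fun σ => ∏ i, u i (σ i)) univ_nonempty
  have hσ : ∀ π : Equiv.Perm ι, ∏ i, u i (π i) ≤ ∏ i, u i (σ i) := fun π => hσ π (mem_univ _)
  -- A column in which no marked entry is the only one used by optimal permutations: either two
  -- optimal permutations differ there, or the optimal `σ` uses an unmarked entry there.
  obtain ⟨j₀, hj₀⟩ : ∃ j₀, ∀ i, t i j₀ → ∃ i' ≠ i, ∃ ρ : Equiv.Perm ι, ρ i' = j₀ ∧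
      ∀ π : Equiv.Perm ι, ∏ i, u i (π i) ≤ ∏ i, u i (ρ i) := by
    by_cases hreal : ∀ i, t i (σ i)
    · have hex : ∃ τ : Equiv.Perm ι, τ ≠ 1 ∧ ∏ i, u i (σ i) ≤ ∏ i, u i (σ (τ i)) := by
        by_contra hcon
        push Not at hcon
        exact h ⟨σ, hreal, hcon⟩
      obtain ⟨τ, hτ, hle⟩ := hex
      obtain ⟨a, ha⟩ : ∃ a, τ a ≠ a := by
        by_contra hcon
        push Not at hcon
        exact hτ (Equiv.ext hcon)
      refine ⟨σ (τ a), fun i _ => ?_⟩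
      by_cases hia : i = a
      · exact ⟨τ a, hia ▸ ha, σ, rfl, hσ⟩
      · exact ⟨a, Ne.symm hia, σ * τ, rfl, fun π => (hσ π).trans hle⟩
    · push Not at hreal
      obtain ⟨a, ha⟩ := hreal
      refine ⟨σ a, fun i hi => ⟨a, ?_, σ, rfl, hσ⟩⟩
      rintro rfl
      exact ha hi
  -- The weight of row `i` will be the tropical cofactor at `(i, j₀)`, attained by `π i`.
  have hmax : ∀ i, ∃ π : Equiv.Perm ι, π i = j₀ ∧ ∀ π' : Equiv.Perm ι, π' i = j₀ →
      ∏ k ∈ univ.erase i, u k (π' k) ≤ ∏ k ∈ univ.erase i, u k (π k) := by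
    intro i
    obtain ⟨π, hπ, hle⟩ := Finset.exists_max_image
      (univ.filter fun π : Equiv.Perm ι => π i = j₀) (fun π => ∏ k ∈ univ.erase i, u k (π k))
      ⟨Equiv.swap i j₀, by simp⟩
    exact ⟨π, by simpa using hπ, fun π' h' => hle π' (by simpa using h')⟩
  choose π hπ hπmax using hmax
  have hxpos : ∀ i, 0 < ∏ k ∈ univ.erase i, u k (π i k) :=
    fun i => Finset.prod_pos fun k _ => hu _ _
  refine ⟨fun i => ∏ k ∈ univ.erase i, u k (π i k), fun i => (hxpos i).le,
    fun h0 => (hxpos j₀).ne' (congrFun h0 j₀), fun i j hij => ?_⟩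
  by_cases hj : j = j₀
  · subst hj
    obtain ⟨i', hi', ρ, hρ, hρmax⟩ := hj₀ i hij
    refine ⟨i', hi', ?_⟩
    calc u i j * ∏ k ∈ univ.erase i, u k (π i k)
        = ∏ k, u k (π i k) := by
          rw [← Finset.mul_prod_erase univ (fun k => u k (π i k)) (mem_univ i), hπ]
      _ ≤ ∏ k, u k (ρ k) := hρmax _
      _ = u i' j * ∏ k ∈ univ.erase i', u k (ρ k) := by
          rw [← Finset.mul_prod_erase univ (fun k => u k (ρ k)) (mem_univ i'), hρ]
      _ ≤ _ := mul_le_mul_of_nonneg_left (hπmax i' ρ hρ) (hu _ _).le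
  -- Exchanging the columns of `i` and `i'` turns a competitor for the cofactor of `i` into one for
  -- that of `i'`.
  · set i' := (π i).symm j with hi'
    have hπi' : π i i' = j := by simp [hi']
    have hne : i' ≠ i := by
      intro he
      rw [he, hπ] at hπi'
      exact hj hπi'.symm
    refine ⟨i', hne, ?_⟩
    set π' := π i * Equiv.swap i i' with hπ'
    have h1 : π' i = j := by simp [hπ', hπi']
    have h2 : π' i' = j₀ := by simp [hπ', hπ]
    have h3 : ∏ k ∈ (univ.erase i).erase i', u k (π i k)
        = ∏ k ∈ (univ.erase i).erase i', u k (π' k) := by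
      refine Finset.prod_congr rfl fun k hk => ?_
      simp only [mem_erase, mem_univ, and_true] at hk
      rw [hπ', Equiv.Perm.mul_apply, Equiv.swap_apply_of_ne_of_ne hk.2 hk.1]
    calc u i j * ∏ k ∈ univ.erase i, u k (π i k)
        = u i' j * ∏ k ∈ univ.erase i', u k (π' k) := by
          rw [← Finset.mul_prod_erase (univ.erase i) (fun k => u k (π i k)) (a := i')
              (by simp [hne]),
            ← Finset.mul_prod_erase (univ.erase i') (fun k => u k (π' k)) (a := i)
              (by simp [hne.symm]), h3, Finset.erase_right_comm, hπi', h1]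
          ring
      _ ≤ _ := mul_le_mul_of_nonneg_left (hπmax i' π' h2) (hu _ _).le

/-- Normalised balanced vectors lie on a compact sphere. At a limit point, a strict violation would
persist along the subsequence, since there are finitely many rows. -/
theorem hasBalancedVector_of_tendsto {w : ι → κ → ℝ} {u v : ℕ → ι → κ → ℝ} {t : ι → κ → Prop}
    (hu : ∀ i j, Tendsto (fun n => u n i j) atTop (𝓝 (w i j)))
    (hv : ∀ i j, Tendsto (fun n => v n i j) atTop (𝓝 (w i j)))
    (h : ∀ n, HasBalancedVector (u n) (v n) t) : HasBalancedVector w w t := by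
  have h' : ∀ n, ∃ x ∈ Metric.sphere (0 : ι → ℝ) 1, 0 ≤ x ∧
      ∀ i j, t i j → ∃ i' ≠ i, u n i j * x i ≤ v n i' j * x i' := by
    intro n
    obtain ⟨x, hx0, hxne, hx⟩ := h n
    have hnorm : 0 < ‖x‖ := norm_pos_iff.2 hxne
    refine ⟨‖x‖⁻¹ • x, ?_, smul_nonneg (inv_nonneg.2 hnorm.le) hx0, fun i j hij => ?_⟩
    · simp [norm_smul, hnorm.ne']
    · obtain ⟨i', hi', hle⟩ := hx i j hij
      refine ⟨i', hi', ?_⟩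
      have := mul_le_mul_of_nonneg_left hle (inv_nonneg.2 hnorm.le)
      simp only [Pi.smul_apply, smul_eq_mul]
      linarith
  choose x hxs hx0 hx using h'
  obtain ⟨y, hy, φ, hφ, hlim⟩ := (isCompact_sphere (0 : ι → ℝ) 1).tendsto_subseq hxs
  have hlim' : ∀ i, Tendsto (fun n => x (φ n) i) atTop (𝓝 (y i)) :=
    fun i => (tendsto_pi_nhds.1 hlim) i
  refine ⟨y, fun i => ge_of_tendsto' (hlim' i) fun n => hx0 (φ n) i, ?_, fun i j hij => ?_⟩
  · rintro rfl
    simp at hy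
  · by_contra hcon
    push Not at hcon
    have hev : ∀ᶠ n in atTop, ∀ i' : ι, i' ≠ i →
        v (φ n) i' j * x (φ n) i' < u (φ n) i j * x (φ n) i := by
      refine eventually_all.2 fun i' => ?_
      by_cases hi' : i' = i
      · exact Eventually.of_forall fun n hne => absurd hi' hne
      · filter_upwards [(((hv i' j).comp hφ.tendsto_atTop).mul (hlim' i')).eventually_lt
          (((hu i j).comp hφ.tendsto_atTop).mul (hlim' i)) (hcon i' hi')] with n hn _
        exact hn
    obtain ⟨n, hn⟩ := hev.exists
    obtain ⟨i', hi', hle⟩ := hx (φ n) i j hij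
    exact absurd hle (not_le.2 (hn i' hi'))

/-- Zeros are perturbed to small positive numbers. Marked entries do not change and the others only
grow, so a strict transversal of the perturbed array is one of the original. -/
theorem hasBalancedVector_of_square {w : ι → ι → ℝ} {t : ι → ι → Prop}
    (hw : ∀ i j, 0 ≤ w i j) (ht : ∀ i j, t i j → 0 < w i j)
    (h : ¬ HasStrictTransversal w t) : HasBalancedVector w w t := by
  classical
  set u : ℕ → ι → ι → ℝ := fun n i j => if w i j = 0 then 1 / ((n : ℝ) + 1) else w i j with hu
  have hlim : ∀ i j, Tendsto (fun n => u n i j) atTop (𝓝 (w i j)) := by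
    intro i j
    by_cases h0 : w i j = 0
    · simpa [hu, h0] using tendsto_one_div_add_atTop_nhds_zero_nat (𝕜 := ℝ)
    · simp [hu, h0]
  refine hasBalancedVector_of_tendsto hlim hlim fun n => hasBalancedVector_of_pos ?_ ?_
  · intro i j
    simp only [hu]
    split_ifs with h0
    · positivity
    · exact lt_of_le_of_ne (hw i j) (Ne.symm h0)
  · rintro ⟨c, hct, hc⟩
    refine h ⟨c, hct, fun τ hτ => ?_⟩
    have h1 : ∏ i, u n i (c i) = ∏ i, w i (c i) :=
      Finset.prod_congr rfl fun i _ => by simp [hu, (ht _ _ (hct i)).ne']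
    refine lt_of_le_of_lt (Finset.prod_le_prod (fun i _ => hw _ _) fun i _ => ?_)
      (h1 ▸ hc τ hτ)
    simp only [hu]
    split_ifs with h0
    · rw [h0]; positivity
    · exact le_rfl

end

/-! ### Rectangular arrays by Helly's theorem -/

section

variable {ι κ : Type*} [Fintype ι]

/-- Helly's theorem for convex subsets of the standard simplex on `ι`, whose dimension is one less
than the number of elements of `ι`. -/
theorem nonempty_iInter_of_subset_stdSimplex [Fintype κ] [Nonempty κ] [Nonempty ι]
    {C : κ → Set (ι → ℝ)} (hconv : ∀ j, Convex ℝ (C j)) (hsub : ∀ j, C j ⊆ stdSimplex ℝ ι)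
    (hC : ∀ c : ι → κ, (⋂ i, C (c i)).Nonempty) : (⋂ j, C j).Nonempty := by
  classical
  set s : (ι → ℝ) →ₗ[ℝ] ℝ := ∑ i, LinearMap.proj i with hs
  have hs_apply : ∀ x, s x = ∑ i, x i := fun x => by simp [hs]
  obtain ⟨i₀⟩ := ‹Nonempty ι›
  set p : ι → ℝ := Pi.single i₀ 1 with hp
  have hsp : s p = 1 := by simp [hs_apply, hp]
  have hrank : Module.finrank ℝ (LinearMap.ker s) + 1 = Fintype.card ι := by
    have h1 := LinearMap.finrank_range_add_finrank_ker s
    have h2 : LinearMap.range s = ⊤ := LinearMap.range_eq_top.2 fun r =>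
      ⟨r • p, by rw [map_smul, hsp, smul_eq_mul, mul_one]⟩
    rw [h2, finrank_top, Module.finrank_self, Module.finrank_fintype_fun_eq_card] at h1
    omega
  set F : κ → Set (LinearMap.ker s) := fun j => {y | p + (y : ι → ℝ) ∈ C j} with hF
  have hFconv : ∀ j ∈ (univ : Finset κ), Convex ℝ (F j) := fun j _ =>
    ((hconv j).translate_preimage_right p).linear_preimage (LinearMap.ker s).subtype
  obtain ⟨y, hy⟩ := Convex.helly_theorem' hFconv fun I _ hI => by
    rcases I.eq_empty_or_nonempty with rfl | hne
    · simp
    · have : Nonempty I := hne.to_subtype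
      rw [hrank] at hI
      obtain ⟨e⟩ : Nonempty (I ↪ ι) :=
        Function.Embedding.nonempty_of_card_le (by simpa using hI)
      -- A subfamily of at most `card ι` sets is listed by `ι`, with repetitions.
      obtain ⟨x, hx⟩ := hC fun i => (Function.invFun e i : I)
      rw [Set.mem_iInter] at hx
      have hker : x - p ∈ LinearMap.ker s := by
        rw [LinearMap.mem_ker, map_sub, hsp, hs_apply, (hsub _ (hx i₀)).2, sub_self]
      refine ⟨⟨x - p, hker⟩, ?_⟩
      simp only [Set.mem_iInter, hF, Set.mem_ofPred_eq, add_sub_cancel]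
      intro j hj
      have := hx (e ⟨j, hj⟩)
      rwa [Function.leftInverse_invFun e.injective] at this
  refine ⟨p + y, ?_⟩
  simpa [hF] using hy

theorem exists_ne_le_card_mul {a : ι → ℝ} (ha : ∀ i, 0 ≤ a i) [DecidableEq ι] {i : ι}
    (h : a i ≤ ∑ k ∈ univ.erase i, a k) (h1 : ∃ k, k ≠ i) :
    ∃ k ≠ i, a i ≤ Fintype.card ι * a k := by
  by_contra hcon
  push Not at hcon
  obtain ⟨k, hk⟩ := h1
  have hlt : ∑ k ∈ univ.erase i, Fintype.card ι * a k < ∑ k ∈ univ.erase i, a i :=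
    Finset.sum_lt_sum_of_nonempty ⟨k, by simp [hk]⟩ fun k hk => hcon k (by simpa using hk)
  rw [← Finset.mul_sum, Finset.sum_const, nsmul_eq_mul] at hlt
  have hcard : ((univ.erase i).card : ℝ) ≤ Fintype.card ι := by
    exact_mod_cast Finset.card_le_univ _
  have h2 := mul_le_mul_of_nonneg_left h (Nat.cast_nonneg (α := ℝ) (Fintype.card ι))
  have h3 := mul_le_mul_of_nonneg_right hcard (ha i)
  linarith

/-- A Helly-type statement: if every choice of as many columns as there are rows has a balanced
vector, then a common balanced vector exists up to a factor tending to `1`. -/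
theorem hasBalancedVector_pow [Fintype κ] [Nonempty κ] {w : ι → κ → ℝ} {t : ι → κ → Prop}
    (hw : ∀ i j, 0 ≤ w i j) (ht : ∀ i j, t i j → 0 < w i j)
    (h : ∀ c : ι → κ, HasBalancedVector (fun i j => w i (c j)) (fun i j => w i (c j))
      fun i j => t i (c j)) (n : ℕ) :
    HasBalancedVector w (fun i j => (Fintype.card ι : ℝ) ^ (1 / ((n : ℝ) + 1)) * w i j) t := by
  classical
  -- After passing to powers, the maximum over the other rows is relaxed to a sum, which makes each
  -- condition linear in `y`.
  set C : κ → Set (ι → ℝ) := fun j => stdSimplex ℝ ι ∩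
    ⋂ i, {y | t i j → w i j ^ (n + 1) * y i ≤ ∑ k ∈ univ.erase i, w k j ^ (n + 1) * y k} with hC
  have : Nonempty ι := by
    obtain ⟨x, -, hx, -⟩ := h fun _ => Classical.arbitrary κ
    obtain ⟨i, -⟩ := Function.ne_iff.1 hx
    exact ⟨i⟩
  have hconv : ∀ j, Convex ℝ (C j) := by
    refine fun j => (convex_stdSimplex ℝ ι).inter (convex_iInter fun i => ?_)
    intro x hx y hy a b ha hb _ htij
    have hx' := mul_le_mul_of_nonneg_left (hx htij) ha
    have hy' := mul_le_mul_of_nonneg_left (hy htij) hb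
    rw [Finset.mul_sum] at hx' hy'
    have := add_le_add hx' hy'
    rw [← Finset.sum_add_distrib] at this
    simp only [Pi.add_apply, Pi.smul_apply, smul_eq_mul]
    calc w i j ^ (n + 1) * (a * x i + b * y i)
        = a * (w i j ^ (n + 1) * x i) + b * (w i j ^ (n + 1) * y i) := by ring
      _ ≤ _ := this
      _ = _ := Finset.sum_congr rfl fun k _ => by ring
  obtain ⟨y, hy⟩ := nonempty_iInter_of_subset_stdSimplex hconv (fun j => Set.inter_subset_left)
    fun c => by
      obtain ⟨x, hx0, hxne, hx⟩ := h c
      have hx0 : ∀ i, 0 ≤ x i := hx0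
      obtain ⟨a, ha⟩ := Function.ne_iff.1 hxne
      have hS : 0 < ∑ i, x i ^ (n + 1) :=
        Finset.sum_pos' (fun i _ => pow_nonneg (hx0 i) _)
          ⟨a, mem_univ _, pow_pos (lt_of_le_of_ne (hx0 a) (Ne.symm ha)) _⟩
      set S := ∑ i, x i ^ (n + 1) with hSdef
      -- The normalised powers of a balanced vector satisfy the relaxed conditions, since one
      -- summand already suffices.
      refine ⟨fun i => x i ^ (n + 1) / S, ?_⟩
      simp only [hC, Set.mem_iInter, Set.mem_inter_iff, Set.mem_ofPred_eq]
      refine fun j => ⟨⟨fun i => div_nonneg (pow_nonneg (hx0 i) _) hS.le, ?_⟩, fun i hij => ?_⟩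
      · rw [← Finset.sum_div, ← hSdef, div_self hS.ne']
      · obtain ⟨k, hk, hle⟩ := hx i j hij
        have hpow := pow_le_pow_left₀ (mul_nonneg (hw _ _) (hx0 i)) hle (n + 1)
        rw [mul_pow, mul_pow] at hpow
        calc w i (c j) ^ (n + 1) * (x i ^ (n + 1) / S)
            = w i (c j) ^ (n + 1) * x i ^ (n + 1) / S := by ring
          _ ≤ w k (c j) ^ (n + 1) * x k ^ (n + 1) / S := by gcongr
          _ = w k (c j) ^ (n + 1) * (x k ^ (n + 1) / S) := by ring
          _ ≤ _ := Finset.single_le_sum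
              (f := fun k => w k (c j) ^ (n + 1) * (x k ^ (n + 1) / S))
              (fun k _ => mul_nonneg (pow_nonneg (hw _ _) _)
                (div_nonneg (pow_nonneg (hx0 k) _) hS.le)) (by simp [hk])
  simp only [hC, Set.mem_iInter, Set.mem_inter_iff, Set.mem_ofPred_eq] at hy
  have hy0 : ∀ i, 0 ≤ y i := (hy (Classical.arbitrary κ)).1.1
  have hy1 : ∑ i, y i = 1 := (hy (Classical.arbitrary κ)).1.2
  have hn : (n + 1 : ℕ) ≠ 0 := n.succ_ne_zero
  have hroot : ∀ r : ℝ, 0 ≤ r → (r ^ (1 / ((n : ℝ) + 1))) ^ (n + 1) = r := by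
    intro r hr
    have := Real.rpow_inv_natCast_pow hr hn
    rw [one_div]
    exact_mod_cast this
  refine ⟨fun i => y i ^ (1 / ((n : ℝ) + 1)), fun i => Real.rpow_nonneg (hy0 i) _, ?_, ?_⟩
  · intro h0
    have : ∀ i, y i = 0 := by
      intro i
      have h2 := congrFun h0 i
      simp only [Pi.zero_apply] at h2
      rw [← hroot (y i) (hy0 i), h2, zero_pow hn]
    simp [this] at hy1
  · intro i j hij
    have hle := (hy j).2 i hij
    -- With a single row the sum is empty and would bound a positive marked entry by zero.
    have hex : ∃ k, k ≠ i := by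
      by_contra hcon
      push Not at hcon
      have he : univ.erase i = ∅ := by
        ext k
        simp [hcon k]
      have h2 : y i = 1 := by
        rw [← hy1, ← Finset.add_sum_erase univ y (mem_univ i), he, Finset.sum_empty, add_zero]
      rw [he, Finset.sum_empty, h2, mul_one] at hle
      exact absurd hle (not_le.2 (pow_pos (ht i j hij) _))
    obtain ⟨k, hk, hle⟩ := exists_ne_le_card_mul
      (a := fun k => w k j ^ (n + 1) * y k) (fun k => mul_nonneg (pow_nonneg (hw _ _) _) (hy0 k))
      hle hex
    refine ⟨k, hk, ?_⟩
    rw [← pow_le_pow_iff_left₀ (mul_nonneg (hw _ _) (Real.rpow_nonneg (hy0 i) _))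
      (mul_nonneg (mul_nonneg (Real.rpow_nonneg (Nat.cast_nonneg _) _) (hw _ _))
        (Real.rpow_nonneg (hy0 k) _)) hn]
    rw [mul_pow, mul_pow, mul_pow, hroot _ (hy0 i), hroot _ (hy0 k), hroot _ (Nat.cast_nonneg _),
      mul_assoc]
    exact hle

/-- A nonnegative array has no balanced vector if and only if it has a strict transversal of
marked entries. -/
theorem not_hasBalancedVector_iff [Fintype κ] {w : ι → κ → ℝ} {t : ι → κ → Prop}
    (hw : ∀ i j, 0 ≤ w i j) (ht : ∀ i j, t i j → 0 < w i j) :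
    ¬ HasBalancedVector w w t ↔ HasStrictTransversal w t := by
  refine ⟨fun hb => ?_, not_hasBalancedVector_of_hasStrictTransversal hw ht⟩
  by_contra hs
  refine hb ?_
  rcases isEmpty_or_nonempty κ with hκ | hκ
  · rcases isEmpty_or_nonempty ι with hι | hι
    · exact absurd ⟨isEmptyElim, isEmptyElim, fun τ hτ => absurd (Subsingleton.elim τ 1) hτ⟩ hs
    · exact ⟨1, zero_le_one, one_ne_zero, fun _ j => isEmptyElim j⟩
  -- A strict transversal of any selection of columns is one of the whole array.
  have hsq : ∀ c : ι → κ, HasBalancedVector (fun i j => w i (c j)) (fun i j => w i (c j))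
      fun i j => t i (c j) := by
    intro c
    refine hasBalancedVector_of_square (fun _ _ => hw _ _) (fun _ _ => ht _ _) ?_
    rintro ⟨d, hd, hlt⟩
    exact hs ⟨fun i => c (d i), hd, hlt⟩
  have : Nonempty ι := by
    obtain ⟨x, -, hx, -⟩ := hsq fun _ => Classical.arbitrary κ
    obtain ⟨i, -⟩ := Function.ne_iff.1 hx
    exact ⟨i⟩
  refine hasBalancedVector_of_tendsto (fun _ _ => tendsto_const_nhds) (fun i j => ?_)
    (hasBalancedVector_pow hw ht hsq)
  have hcard : (Fintype.card ι : ℝ) ≠ 0 := by exact_mod_cast Fintype.card_ne_zero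
  have h1 : Tendsto (fun n : ℕ => (Fintype.card ι : ℝ) ^ (1 / ((n : ℝ) + 1))) atTop (𝓝 1) := by
    have := (Real.continuousAt_const_rpow (b := 0) hcard).tendsto.comp
      (tendsto_one_div_add_atTop_nhds_zero_nat (𝕜 := ℝ))
    rwa [Real.rpow_zero] at this
  simpa using h1.mul_const (w i j)

end

theorem HasStrictTransversal.reindex {ι ι' κ : Type*} [Fintype ι] [Fintype ι'] (e : ι ≃ ι')
    {w : ι' → κ → ℝ} {t : ι' → κ → Prop} (h : HasStrictTransversal w t) :
    HasStrictTransversal (fun i => w (e i)) fun i => t (e i) := by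
  obtain ⟨c, hct, hc⟩ := h
  refine ⟨fun i => c (e i), fun i => hct _, fun τ hτ => ?_⟩
  have hne : e.permCongr τ ≠ 1 := by
    intro h1
    refine hτ (Equiv.ext fun i => ?_)
    have := Equiv.congr_fun h1 (e i)
    simpa using this
  have := hc _ hne
  rw [← Equiv.prod_comp e, ← Equiv.prod_comp e (fun i => w i (c i))] at this
  simpa using this

/-! ### From the extended tropical semiring to real arrays -/

namespace ExtTrop

/-- The exponential of the underlying real number, with `-∞` sent to `0`. -/
noncomputable def expVal : ExtTrop → ℝ
  | negInf => 0
  | real a => Real.exp a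
  | ghost a => Real.exp a

theorem expVal_nonneg (x : ExtTrop) : 0 ≤ expVal x := by
  rcases x with _ | a | a <;> simp [expVal, Real.exp_nonneg]

theorem notMem_ghostBar_iff {x : ExtTrop} : x ∉ ghostBar ↔ ∃ a, x = real a := by
  rcases x with _ | a | a <;> simp [ghostBar]

theorem expVal_pos {x : ExtTrop} (h : x ∉ ghostBar) : 0 < expVal x := by
  obtain ⟨a, rfl⟩ := notMem_ghostBar_iff.1 h
  exact Real.exp_pos a

theorem expVal_mul (x y : ExtTrop) : expVal (x * y) = expVal x * expVal y := by
  rcases x with _ | a | a <;> rcases y with _ | b | b <;>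
    simp [mul_def, tmul, expVal, Real.exp_add]

theorem expVal_one : expVal 1 = 1 := by simp [expVal]

theorem expVal_prod {ι : Type*} (s : Finset ι) (f : ι → ExtTrop) :
    expVal (∏ i ∈ s, f i) = ∏ i ∈ s, expVal (f i) := by
  classical
  induction s using Finset.induction_on with
  | empty => simp [expVal_one]
  | insert a s ha ih => rw [Finset.prod_insert ha, Finset.prod_insert ha, expVal_mul, ih]

theorem mul_notMem_ghostBar {x y : ExtTrop} :
    x * y ∉ ghostBar ↔ x ∉ ghostBar ∧ y ∉ ghostBar := by
  rcases x with _ | a | a <;> rcases y with _ | b | b <;> simp [mul_def, tmul, ghostBar]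

theorem prod_notMem_ghostBar {ι : Type*} (s : Finset ι) (f : ι → ExtTrop) :
    ∏ i ∈ s, f i ∉ ghostBar ↔ ∀ i ∈ s, f i ∉ ghostBar := by
  classical
  induction s using Finset.induction_on with
  | empty => simp [one_def, ghostBar]
  | insert a s ha ih => rw [Finset.prod_insert ha, mul_notMem_ghostBar, ih, forall_mem_insert]

theorem expVal_add (x y : ExtTrop) : expVal (x + y) = max (expVal x) (expVal y) := by
  have hexp : ∀ a : ℝ, max 0 (Real.exp a) = Real.exp a := fun a => max_eq_right a.exp_pos.le
  have hexp' : ∀ a : ℝ, max (Real.exp a) 0 = Real.exp a := fun a => max_eq_left a.exp_pos.le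
  rcases x with _ | a | a <;> rcases y with _ | b | b <;>
    simp only [add_def, tadd, tmax] <;>
    grind [prec, nu, expVal, Real.exp_le_exp, Real.exp_lt_exp]

theorem add_notMem_ghostBar {x y : ExtTrop} : x + y ∉ ghostBar ↔
    x ∉ ghostBar ∧ expVal y < expVal x ∨ y ∉ ghostBar ∧ expVal x < expVal y := by
  simp only [notMem_ghostBar_iff]
  rcases x with _ | a | a <;> rcases y with _ | b | b <;>
    simp only [add_def, tadd, tmax] <;>
    grind [prec, nu, expVal, Real.exp_lt_exp, Real.exp_pos]

theorem expVal_sum_lt {ι : Type*} (s : Finset ι) (f : ι → ExtTrop) {c : ℝ} (hc : 0 < c) :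
    expVal (∑ i ∈ s, f i) < c ↔ ∀ i ∈ s, expVal (f i) < c := by
  classical
  induction s using Finset.induction_on with
  | empty => simpa [zero_def, expVal] using hc
  | insert a s ha ih => rw [Finset.sum_insert ha, expVal_add, max_lt_iff, ih, forall_mem_insert]

/-- Ties create ghosts, so a sum is real only when one real summand strictly dominates all the
others. -/
theorem sum_notMem_ghostBar {ι : Type*} (s : Finset ι) (f : ι → ExtTrop) :
    ∑ i ∈ s, f i ∉ ghostBar ↔
      ∃ i ∈ s, f i ∉ ghostBar ∧ ∀ k ∈ s, k ≠ i → expVal (f k) < expVal (f i) := by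
  classical
  constructor
  · induction s using Finset.induction_on with
    | empty => simp [zero_def, ghostBar]
    | insert a s ha ih =>
      rw [Finset.sum_insert ha, add_notMem_ghostBar]
      rintro (⟨h1, h2⟩ | ⟨h1, h2⟩)
      · rw [expVal_sum_lt s f (expVal_pos h1)] at h2
        exact ⟨a, mem_insert_self _ _, h1, fun k hk hka => h2 k (mem_of_mem_insert_of_ne hk hka)⟩
      · obtain ⟨i, hi, h3, h4⟩ := ih h1
        refine ⟨i, mem_insert_of_mem hi, h3, fun k hk hki => ?_⟩
        rcases mem_insert.1 hk with rfl | hk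
        · refine lt_of_lt_of_le h2 (not_lt.1 fun h5 => ?_)
          rw [← Finset.add_sum_erase s f hi, expVal_add, lt_max_iff] at h5
          rcases h5 with h5 | h5
          · exact lt_irrefl _ h5
          · exact lt_asymm h5 ((expVal_sum_lt _ f (expVal_pos h3)).2 fun k hk =>
              h4 k (mem_of_mem_erase hk) (ne_of_mem_erase hk))
        · exact h4 k hk hki
  · rintro ⟨i, hi, h1, h2⟩
    rw [← Finset.add_sum_erase s f hi, add_notMem_ghostBar]
    exact Or.inl ⟨h1, (expVal_sum_lt _ f (expVal_pos h1)).2 fun k hk =>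
      h2 k (mem_of_mem_erase hk) (ne_of_mem_erase hk)⟩

theorem sum_mem_ghostBar {ι : Type*} [Fintype ι] (f : ι → ExtTrop) :
    ∑ i, f i ∈ ghostBar ↔
      ∀ i, f i ∉ ghostBar → ∃ k ≠ i, expVal (f i) ≤ expVal (f k) := by
  rw [← not_iff_not, sum_notMem_ghostBar]
  push Not
  simp

theorem tropDependent_iff {ι : Type*} [Fintype ι] {n : ℕ} (v : ι → Fin n → ExtTrop) :
    TropDependent v ↔ HasBalancedVector (fun i j => expVal (v i j)) (fun i j => expVal (v i j))
      fun i j => v i j ∉ ghostBar := by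
  simp only [TropDependent, HasBalancedVector, Finset.sum_apply, Pi.smul_apply, smul_eq_mul,
    sum_mem_ghostBar, mul_notMem_ghostBar, expVal_mul]
  constructor
  · rintro ⟨α, hα, ⟨i₀, hi₀⟩, h⟩
    have hreal : ∀ i, α i ≠ negInf → α i ∉ ghostBar := fun i hi =>
      notMem_ghostBar_iff.2 ((hα i).resolve_left hi)
    refine ⟨fun i => expVal (α i), fun i => expVal_nonneg _, fun h0 => ?_, fun i j hij => ?_⟩
    · exact (expVal_pos (hreal i₀ hi₀)).ne' (congrFun h0 i₀)
    · by_cases hi : α i = negInf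
      -- A row with coefficient `-∞` contributes zero, which any other row bounds.
      · refine ⟨i₀, fun he => hi₀ (he ▸ hi), ?_⟩
        simp only [hi, expVal, mul_zero]
        exact mul_nonneg (expVal_nonneg _) (expVal_nonneg _)
      · obtain ⟨k, hk, hle⟩ := h j i ⟨hreal i hi, hij⟩
        exact ⟨k, hk, by simpa only [mul_comm] using hle⟩
  · rintro ⟨x, hx0, hxne, h⟩
    obtain ⟨i₀, hi₀⟩ := Function.ne_iff.1 hxne
    set α : ι → ExtTrop := fun i => if x i = 0 then negInf else real (Real.log (x i)) with hα
    have hval : ∀ i, expVal (α i) = x i := by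
      intro i
      simp only [hα]
      split_ifs with h0
      · exact h0.symm
      · exact Real.exp_log (lt_of_le_of_ne (hx0 i) (Ne.symm h0))
    refine ⟨α, fun i => ?_, ⟨i₀, ?_⟩, fun j i hij => ?_⟩
    · simp only [hα]
      split_ifs
      · exact Or.inl rfl
      · exact Or.inr ⟨_, rfl⟩
    · have hi₀ : x i₀ ≠ 0 := hi₀
      simp [hα, hi₀]
    · obtain ⟨k, hk, hle⟩ := h i j hij.2
      exact ⟨k, hk, by simpa only [hval, mul_comm] using hle⟩

theorem tropIndependent_iff {ι : Type*} [Fintype ι] {n : ℕ} (v : ι → Fin n → ExtTrop) :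
    TropIndependent v ↔
      HasStrictTransversal (fun i j => expVal (v i j)) fun i j => v i j ∉ ghostBar := by
  rw [TropIndependent, tropDependent_iff]
  exact not_hasBalancedVector_iff (fun _ _ => expVal_nonneg _) fun _ _ => expVal_pos

/-! ### Nonsingular minors and transposition -/

theorem not_tropSingular_iff {k : ℕ} (B : Matrix (Fin k) (Fin k) ExtTrop) :
    ¬ TropSingular B ↔ ∃ σ : Equiv.Perm (Fin k), (∀ i, B i (σ i) ∉ ghostBar) ∧
      ∀ τ : Equiv.Perm (Fin k), τ ≠ σ → ∏ i, expVal (B i (τ i)) < ∏ i, expVal (B i (σ i)) := by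
  simp [TropSingular, tropDet, sum_notMem_ghostBar, prod_notMem_ghostBar, expVal_prod]

/-- The strict transversal of an independent set of rows selects the columns of the minor, and the
unique optimal permutation of a nonsingular minor is a strict transversal of its rows. -/
theorem mem_nonsingularMinorSizes_iff {m n k : ℕ} (A : Matrix (Fin m) (Fin n) ExtTrop) :
    k ∈ nonsingularMinorSizes A ↔
      ∃ s : Finset (Fin m), TropIndependent (fun i : s => A.row i) ∧ s.card = k := by
  classical
  simp only [nonsingularMinorSizes, Set.mem_ofPred_eq, not_tropSingular_iff, tropIndependent_iff,
    Matrix.submatrix_apply, Matrix.row]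
  constructor
  · rintro ⟨r, c, σ, hσ, hlt⟩
    refine ⟨univ.map r.toEmbedding, ?_, by simp⟩
    have hT : HasStrictTransversal (fun i j => expVal (A (r i) j))
        fun i j => A (r i) j ∉ ghostBar :=
      ⟨fun i => c (σ i), hσ, fun τ hτ => hlt (σ * τ) (by simpa using hτ)⟩
    set e : Fin k ≃ (univ.map r.toEmbedding : Finset (Fin m)) := Equiv.ofBijective
      (fun i => ⟨r i, by simp⟩) ⟨fun i j h => by simpa using h, fun ⟨a, ha⟩ => by
        obtain ⟨i, -, rfl⟩ := Finset.mem_map.1 ha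
        exact ⟨i, rfl⟩⟩ with he
    have hre : ∀ i, r (e.symm i) = i := fun i =>
      congrArg Subtype.val (e.apply_symm_apply i)
    simpa only [hre] using hT.reindex e.symm
  · rintro ⟨s, hs, rfl⟩
    obtain ⟨c, hct, hc⟩ := hs.reindex (s.orderIsoOfFin rfl).toEquiv
    have hinj : Function.Injective c := by
      -- If two rows shared a column, swapping them would leave the product unchanged, against
      -- strictness.
      intro a b hab
      by_contra hne
      refine (hc (Equiv.swap a b) (by simpa [Equiv.swap_eq_one_iff] using hne)).ne
        (Finset.prod_congr rfl fun i _ => ?_)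
      congr 1
      rcases eq_or_ne i a with rfl | hia
      · rw [Equiv.swap_apply_left, hab]
      · rcases eq_or_ne i b with rfl | hib
        · rw [Equiv.swap_apply_right, hab]
        · rw [Equiv.swap_apply_of_ne_of_ne hia hib]
    have hcard : (univ.image c).card = s.card := by
      rw [Finset.card_image_of_injective _ hinj, Finset.card_univ, Fintype.card_fin]
    set d := (univ.image c).orderIsoOfFin hcard with hd
    set g : Fin s.card → Fin s.card :=
      fun i => d.symm ⟨c i, Finset.mem_image_of_mem c (mem_univ i)⟩ with hg
    have hginj : Function.Injective g := fun a b hab => hinj (by simpa [hg] using hab)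
    -- A minor lists its columns increasingly; `σ` records the order in which `c` visits them.
    set σ : Equiv.Perm (Fin s.card) :=
      Equiv.ofBijective g (Finite.injective_iff_bijective.1 hginj) with hσ
    have hdσ : ∀ i, (univ.image c).orderEmbOfFin hcard (σ i) = c i := fun i =>
      congrArg Subtype.val (d.apply_symm_apply ⟨c i, Finset.mem_image_of_mem c (mem_univ i)⟩)
    refine ⟨s.orderEmbOfFin rfl, (univ.image c).orderEmbOfFin hcard, σ, fun i => ?_,
      fun τ hτ => ?_⟩
    · rw [hdσ]
      exact hct i
    · have hτ' : ∀ i, τ i = σ ((σ⁻¹ * τ) i) := fun i => by simp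
      simp only [hτ', hdσ]
      exact hc (σ⁻¹ * τ) fun h1 => hτ (inv_mul_eq_one.1 h1).symm

/-- The tropical determinant carries no signs, so it is a permanent. -/
theorem tropDet_transpose {k : ℕ} (B : Matrix (Fin k) (Fin k) ExtTrop) :
    tropDet B.transpose = tropDet B :=
  B.permanent_transpose.symm

theorem nonsingularMinorSizes_transpose {m n : ℕ} (A : Matrix (Fin m) (Fin n) ExtTrop) :
    nonsingularMinorSizes A.transpose = nonsingularMinorSizes A := by
  ext k
  simp only [nonsingularMinorSizes, Set.mem_ofPred_eq, TropSingular]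
  rw [exists_comm]
  simp only [← Matrix.transpose_submatrix, tropDet_transpose]

theorem isGreatest_tropRank {m n : ℕ} (A : Matrix (Fin m) (Fin n) ExtTrop) :
    IsGreatest (nonsingularMinorSizes A) (tropRank A) := by
  classical
  constructor
  · rw [mem_nonsingularMinorSizes_iff]
    have hne : (univ.filter fun s : Finset (Fin m) =>
        TropIndependent fun i : s => A.row i).Nonempty := by
      refine ⟨∅, mem_filter.2 ⟨mem_univ _, ?_⟩⟩
      rintro ⟨-, -, ⟨i, -⟩, -⟩
      exact absurd i.2 (notMem_empty _)
    obtain ⟨s, hs, hsup⟩ := Finset.exists_mem_eq_sup _ hne Finset.card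
    refine ⟨s, (mem_filter.1 hs).2, hsup.symm.trans ?_⟩
    simp only [tropRank]
  · intro k hk
    obtain ⟨s, hs, rfl⟩ := (mem_nonsingularMinorSizes_iff A).1 hk
    exact Finset.le_sup (f := Finset.card) (mem_filter.2 ⟨mem_univ _, hs⟩)

end ExtTrop

theorem mainTheorem6 {m n : ℕ} (A : Matrix (Fin m) (Fin n) ExtTrop) :
    ExtTrop.tropRank A = ExtTrop.tropRank A.transpose ∧
      IsGreatest (ExtTrop.nonsingularMinorSizes A) (ExtTrop.tropRank A) ∧
      IsGreatest (ExtTrop.nonsingularMinorSizes A) (ExtTrop.tropRank A.transpose) := by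
  have h1 := ExtTrop.isGreatest_tropRank A
  have h2 := ExtTrop.isGreatest_tropRank A.transpose
  rw [ExtTrop.nonsingularMinorSizes_transpose] at h2
  exact ⟨h1.unique h2, h1, h2⟩
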